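/- Let $M$ parties hold finite-dimensional input systems $A_1,\dots,A_M$ and output systems $A_1',\dots,A_M'$, and let $\mathcal N_{A_1^M\to A_1'^M}$ be a quantum channel (completely positive and trace preserving), where $A_1^M=A_1\cdots A_M$, and similarly for the other systems. Let $\rho_{\hat A_1^M}$ be a quantum state of finite-dimensional systems $\hat A_1,\dots,\hat A_M$, party $i$ holding $\hat A_i$. For $S\subseteq\{1,\dots,M\}$ let $T_S$, $T_{\hat S}$, $T_{S'}$ be the partial transposes on the systems $A_i$, $\hat A_i$, $A_i'$ with $i\in S$ (products of these symbols in a subscript denote the joint partial transpose). A channel $\mathcal P_{A_1^M\hat A_1^M\to A_1'^M}$ is called completely PPT-preserving (C-PPT-P) if $T_{S'}\circ\mathcal P\circ T_{S\hat S}$ is completely positive for every $S\subseteq\{1,\dots,M\}$. It simulates $\mathcal N$ by $\widetilde{\mathcal N}^{\mathcal P}(\omega)=\mathcal P(\omega\otimes\rho_{\hat A_1^M})$. The channel fidelity is $$F(\mathcal N,\mathcal M)=\inf_{\sigma_{RC}}F\big((\mathrm{id}_R\otimes\mathcal N)(\sigma_{RC}),(\mathrm{id}_R\otimes\mathcal M)(\sigma_{RC})\big),\qquad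 F(\omega,\tau)=\|\sqrt\omega\sqrt\tau\|_1^2,$$ where $C=A_1^M$ is the joint input system and the infimum is over all finite-dimensional reference systems $R$ and all states $\sigma_{RC}$. The simulation error is $$e^F_{\mathrm{PPT}}(\mathcal N,\rho_{\hat A_1^M})=\inf_{\mathcal P\in\text{C-PPT-P}}\big(1-F(\mathcal N,\widetilde{\mathcal N}^{\mathcal P})\big).$$ Let $\Gamma^{\mathcal N}_{A_1^MA_1'^M}=(\mathrm{id}\otimes\mathcal N)(|\Gamma\rangle\langle\Gamma|)$ with $|\Gamma\rangle=\sum_i|i\rangle|i\rangle$ be the Choi operator of $\mathcal N$, and write $\operatorname{Re}[X]=\frac12(X+X^\dagger)$. Then $$e^F_{\mathrm{PPT}}(\mathcal N,\rho_{\hat A_1^M})=1-\Big[\sup\lambda\Big]^2,$$ where the supremum is over all real $\lambda\ge0$, all operators $P_{A_1^M\hat A_1^MA_1'^M}\ge0$ and all linear operators $Q_{A_1^MA_1'^M}$ subject to $$\lambda I_{A_1^M}\le\operatorname{Re}\big[\operatorname{Tr}_{A_1'^M}[Q_{A_1^MA_1'^M}]\big],\qquad \operatorname{Tr}_{A_1'^M}[P_{A_1^M\hat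 A_1^MA_1'^M}]=I_{A_1^M\hat A_1^M},$$ $$\begin{bmatrix}\Gamma^{\mathcal N}_{A_1^MA_1'^M}&Q^\dagger_{A_1^MA_1'^M}\\ Q_{A_1^MA_1'^M}&\operatorname{Tr}_{\hat A_1^M}[T_{\hat A_1^M}(\rho_{\hat A_1^M})P_{A_1^M\hat A_1^MA_1'^M}]\end{bmatrix}\ge0,$$ $$T_{S\hat SS'}(P_{A_1^M\hat A_1^MA_1'^M})\ge0\quad\text{for all }S\subseteq\{1,\dots,M\}.$$ Both the infimum and the supremum are over nonempty sets of real numbers, bounded below and above respectively. -/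

import Mathlib

open scoped ComplexOrder MatrixOrder Kronecker

namespace QSim

section Basics

variable {R C D : Type*}

/-- A quantum state (density matrix): positive semidefinite with unit trace. -/
def IsState [Fintype C] (ρ : Matrix C C ℂ) : Prop :=
  ρ.PosSemidef ∧ ρ.trace = 1

/-- The map `id_R ⊗ N`, acting blockwise on operators of the joint system `R C`. -/
def idTensor (R : Type*) (N : Matrix C C ℂ →ₗ[ℂ] Matrix D D ℂ)
    (X : Matrix (R × C) (R × C) ℂ) : Matrix (R × D) (R × D) ℂ :=
  Matrix.of fun x y => N (Matrix.of fun c c' => X (x.1, c) (y.1, c')) x.2 y.2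

/-- Complete positivity: `id_R ⊗ N` preserves positivity for every finite-dimensional `R`. -/
def IsCP (N : Matrix C C ℂ →ₗ[ℂ] Matrix D D ℂ) : Prop :=
  ∀ (n : ℕ) (X : Matrix (Fin n × C) (Fin n × C) ℂ),
    X.PosSemidef → (idTensor (Fin n) N X).PosSemidef

/-- A quantum channel: a completely positive and trace-preserving linear map. -/
def IsChannel [Fintype C] [Fintype D] (N : Matrix C C ℂ →ₗ[ℂ] Matrix D D ℂ) : Prop :=
  IsCP N ∧ ∀ X, (N X).trace = X.trace

/-- The vector `|Γ⟩ = ∑ i, |i⟩|i⟩`. -/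
def gammaVec (C : Type*) [DecidableEq C] : C × C → ℂ :=
  fun x => if x.1 = x.2 then 1 else 0

/-- The unnormalized maximally entangled operator `|Γ⟩⟨Γ|`. -/
def gammaOp (C : Type*) [DecidableEq C] : Matrix (C × C) (C × C) ℂ :=
  Matrix.vecMulVec (gammaVec C) (star (gammaVec C))

/-- The Choi operator `(id ⊗ N)(|Γ⟩⟨Γ|)`. -/
def choi [DecidableEq C] (N : Matrix C C ℂ →ₗ[ℂ] Matrix D D ℂ) :
    Matrix (C × D) (C × D) ℂ :=
  idTensor C N (gammaOp C)

/-- The partial trace over the second tensor factor. -/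
def traceSnd [Fintype D] (X : Matrix (C × D) (C × D) ℂ) : Matrix C C ℂ :=
  Matrix.of fun c c' => ∑ d, X (c, d) (c', d)

/-- The partial trace over the middle one of three tensor factors. -/
def traceMid [Fintype R] (X : Matrix ((C × R) × D) ((C × R) × D) ℂ) :
    Matrix (C × D) (C × D) ℂ :=
  Matrix.of fun x y => ∑ r, X ((x.1, r), x.2) ((y.1, r), y.2)

/-- The trace norm `Tr √(X† X)`. -/
noncomputable def traceNorm [Fintype C] [DecidableEq C] (X : Matrix C C ℂ) : ℝ :=
  (CFC.sqrt (X.conjTranspose * X)).trace.re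

/-- The Uhlmann fidelity `‖√ω √τ‖₁²` of two states. -/
noncomputable def fidelity [Fintype C] [DecidableEq C] (ω τ : Matrix C C ℂ) : ℝ :=
  traceNorm (CFC.sqrt ω * CFC.sqrt τ) ^ 2

/-- The channel fidelity: the infimum over all finite-dimensional reference systems `R` and all
states of `R C` of the fidelity of the two output states. -/
noncomputable def channelFidelity [Fintype C] [Fintype D] [DecidableEq D]
    (N N' : Matrix C C ℂ →ₗ[ℂ] Matrix D D ℂ) : ℝ :=
  sInf {f : ℝ | ∃ (n : ℕ) (ρ : Matrix (Fin n × C) (Fin n × C) ℂ), IsState ρ ∧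
    f = fidelity (idTensor (Fin n) N ρ) (idTensor (Fin n) N' ρ)}

/-- The channel `ω ↦ P (ω ⊗ ρ)` obtained from `P` and a resource state `ρ`. -/
def simulate (P : Matrix (C × R) (C × R) ℂ →ₗ[ℂ] Matrix D D ℂ) (ρ : Matrix R R ℂ) :
    Matrix C C ℂ →ₗ[ℂ] Matrix D D ℂ where
  toFun ω := P (ω ⊗ₖ ρ)
  map_add' ω ω' := by rw [Matrix.add_kronecker, map_add]
  map_smul' c ω := by rw [Matrix.smul_kronecker, map_smul, RingHom.id_apply]

end Basics

section Multipartite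

variable {ι : Type*} [DecidableEq ι] {A Ah A' : ι → Type*}

/-- The partial transpose `T_{S'}` on the systems `A' i`, `i ∈ S`, of a multipartite operator. -/
def transposeOut (S : Finset ι) :
    Matrix (∀ i, A' i) (∀ i, A' i) ℂ →ₗ[ℂ] Matrix (∀ i, A' i) (∀ i, A' i) ℂ where
  toFun X := Matrix.of fun x y => X (S.piecewise y x) (S.piecewise x y)
  map_add' _ _ := rfl
  map_smul' _ _ := rfl

/-- The partial transpose `T_{S Ŝ}` on the systems `A i` and `Ah i`, `i ∈ S`. -/
def transposeIn (S : Finset ι) :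
    Matrix ((∀ i, A i) × (∀ i, Ah i)) ((∀ i, A i) × (∀ i, Ah i)) ℂ →ₗ[ℂ]
      Matrix ((∀ i, A i) × (∀ i, Ah i)) ((∀ i, A i) × (∀ i, Ah i)) ℂ where
  toFun X := Matrix.of fun x y =>
    X (S.piecewise y.1 x.1, S.piecewise y.2 x.2) (S.piecewise x.1 y.1, S.piecewise x.2 y.2)
  map_add' _ _ := rfl
  map_smul' _ _ := rfl

/-- The partial transpose `T_{S Ŝ S'}` on the systems `A i`, `Ah i` and `A' i`, `i ∈ S`. -/
def transposeAll (S : Finset ι)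
    (X : Matrix (((∀ i, A i) × (∀ i, Ah i)) × (∀ i, A' i))
      (((∀ i, A i) × (∀ i, Ah i)) × (∀ i, A' i)) ℂ) :
    Matrix (((∀ i, A i) × (∀ i, Ah i)) × (∀ i, A' i))
      (((∀ i, A i) × (∀ i, Ah i)) × (∀ i, A' i)) ℂ :=
  Matrix.of fun x y =>
    X ((S.piecewise y.1.1 x.1.1, S.piecewise y.1.2 x.1.2), S.piecewise y.2 x.2)
      ((S.piecewise x.1.1 y.1.1, S.piecewise x.1.2 y.1.2), S.piecewise x.2 y.2)

variable [Fintype ι] [∀ i, Fintype (A i)] [∀ i, Fintype (Ah i)] [∀ i, Fintype (A' i)]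

/-- Completely PPT-preserving multipartite channels; party `i` holds the inputs `A i`, `Ah i` and
the output `A' i`. -/
def IsCPPTP (P : Matrix ((∀ i, A i) × (∀ i, Ah i)) ((∀ i, A i) × (∀ i, Ah i)) ℂ →ₗ[ℂ]
    Matrix (∀ i, A' i) (∀ i, A' i) ℂ) : Prop :=
  IsChannel P ∧ ∀ S : Finset ι, IsCP (transposeOut S ∘ₗ P ∘ₗ transposeIn S)

/-- The simulation errors `1 - F(N, Ñ)` achieved by the completely PPT-preserving channels. -/
def simErrors [∀ i, DecidableEq (A' i)]
    (N : Matrix (∀ i, A i) (∀ i, A i) ℂ →ₗ[ℂ] Matrix (∀ i, A' i) (∀ i, A' i) ℂ)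
    (ρ : Matrix (∀ i, Ah i) (∀ i, Ah i) ℂ) : Set ℝ :=
  {e : ℝ | ∃ P : Matrix ((∀ i, A i) × (∀ i, Ah i)) ((∀ i, A i) × (∀ i, Ah i)) ℂ →ₗ[ℂ]
      Matrix (∀ i, A' i) (∀ i, A' i) ℂ,
    IsCPPTP P ∧ e = 1 - channelFidelity N (simulate P ρ)}

/-- The infidelity simulation error minimized over all completely PPT-preserving channels. -/
noncomputable def simErrorPPT [∀ i, DecidableEq (A' i)]
    (N : Matrix (∀ i, A i) (∀ i, A i) ℂ →ₗ[ℂ] Matrix (∀ i, A' i) (∀ i, A' i) ℂ)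
    (ρ : Matrix (∀ i, Ah i) (∀ i, Ah i) ℂ) : ℝ :=
  sInf (simErrors N ρ)

variable [∀ i, DecidableEq (A i)] [∀ i, DecidableEq (Ah i)] [∀ i, DecidableEq (A' i)]

/-- The constraints of the semidefinite program on its variables `l`, `P`, `Q`. Here `realPart X`
is the Hermitian part `(X + X†) / 2`. -/
structure SDPFeasible
    (N : Matrix (∀ i, A i) (∀ i, A i) ℂ →ₗ[ℂ] Matrix (∀ i, A' i) (∀ i, A' i) ℂ)
    (ρ : Matrix (∀ i, Ah i) (∀ i, Ah i) ℂ) (l : ℝ)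
    (P : Matrix (((∀ i, A i) × (∀ i, Ah i)) × (∀ i, A' i))
      (((∀ i, A i) × (∀ i, Ah i)) × (∀ i, A' i)) ℂ)
    (Q : Matrix ((∀ i, A i) × (∀ i, A' i)) ((∀ i, A i) × (∀ i, A' i)) ℂ) : Prop where
  l_nonneg : 0 ≤ l
  P_nonneg : P.PosSemidef
  le_realPart : (l : ℂ) • (1 : Matrix (∀ i, A i) (∀ i, A i) ℂ) ≤
    (realPart (traceSnd Q) : Matrix (∀ i, A i) (∀ i, A i) ℂ)
  trace_P : traceSnd P = 1
  block_nonneg : (Matrix.fromBlocks (choi N) Q.conjTranspose Q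
    (traceMid ((((1 : Matrix (∀ i, A i) (∀ i, A i) ℂ) ⊗ₖ ρ.transpose) ⊗ₖ
      (1 : Matrix (∀ i, A' i) (∀ i, A' i) ℂ)) * P))).PosSemidef
  ppt : ∀ S : Finset ι, (transposeAll S P).PosSemidef

/-- The objective values of the feasible points of the semidefinite program. -/
def sdpValues
    (N : Matrix (∀ i, A i) (∀ i, A i) ℂ →ₗ[ℂ] Matrix (∀ i, A' i) (∀ i, A' i) ℂ)
    (ρ : Matrix (∀ i, Ah i) (∀ i, Ah i) ℂ) : Set ℝ :=
  {l : ℝ | ∃ P Q, SDPFeasible N ρ l P Q}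

end Multipartite

end QSim

/-! The Choi correspondence removes the channel optimization. A partial transpose exchanges the
`S`-coordinates of row and column indices, so pre- and postcomposing a map with partial transposes
is the joint partial transpose of its Choi operator (`choi_transpose`). By Choi's theorem the
constraints on `P` alone then describe the Choi operators of C-PPT-P channels, and the lower right
block is the Choi operator of the simulated channel (`choi_simulate`).

What remains, for fixed channels, is that the root channel fidelity is the largest `λ` for which
some `Q` makes the block matrix positive with `λ I ≤ Re Tr Q`. Feasible `λ` are lower bounds: write
the input state as a sum of rank-one operators given by matrices `K k`, conjugate the block matrix
by `K k ⊗ 1` and sum. The blocks become the two output states and an off-diagonal `X` with `Re Tr X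
≥ λ`, and `Re Tr X` never exceeds the root fidelity (`re_trace_le_of_block`).

Conversely, for each `σ` a purified input and a contraction attaining the root fidelity of its
outputs give a feasible `Q` with `Re Tr (σ Tr Q)` at least the root channel fidelity. This `Q`
depends on `σ`; Sion's minimax theorem, on compact convex sets with a real-bilinear function,
supplies one `Q` good for all `σ`, and self-duality of the positive cone (`le_realPart_iff`) turns
that into the operator inequality. Uhlmann-type facts rest throughout on one principle: matrices
with equal Gram matrices differ by a contraction. -/

namespace QSim

/-! ### Contractions and a polar decomposition. -/

section Contractions

variable {m n p : Type*} [Fintype m] [Fintype n] [Fintype p]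

/-- A matrix `V` is a contraction if `V† V ≤ 1`. -/
def IsContraction [DecidableEq n] (V : Matrix m n ℂ) : Prop :=
  (1 - V.conjTranspose * V).PosSemidef

theorem IsContraction.mul [DecidableEq m] [DecidableEq n] {V : Matrix p m ℂ} {W : Matrix m n ℂ}
    (hV : IsContraction V) (hW : IsContraction W) : IsContraction (V * W) := by
  have h := hW.add (hV.conjTranspose_mul_mul_same W)
  have e : 1 - (V * W).conjTranspose * (V * W) = 1 - W.conjTranspose * W +
      W.conjTranspose * (1 - V.conjTranspose * V) * W := by
    simp only [Matrix.conjTranspose_mul, Matrix.mul_sub, Matrix.sub_mul, Matrix.mul_one,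
      Matrix.mul_assoc]
    abel
  rw [IsContraction, e]
  exact h

/-- This is the identity `1 - V V† = (1 - V V†)² + V (1 - V† V) V†`. -/
theorem IsContraction.conjTranspose [DecidableEq m] [DecidableEq n] {V : Matrix m n ℂ}
    (hV : IsContraction V) : IsContraction V.conjTranspose := by
  have h := (Matrix.posSemidef_conjTranspose_mul_self (1 - V * V.conjTranspose)).add
    (hV.mul_mul_conjTranspose_same V)
  have e : 1 - V.conjTranspose.conjTranspose * V.conjTranspose =
      (1 - V * V.conjTranspose).conjTranspose * (1 - V * V.conjTranspose) +
      V * (1 - V.conjTranspose * V) * V.conjTranspose := by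
    simp only [Matrix.conjTranspose_mul, Matrix.conjTranspose_sub, Matrix.conjTranspose_one,
      Matrix.conjTranspose_conjTranspose, Matrix.mul_sub, Matrix.sub_mul, Matrix.mul_one,
      Matrix.one_mul, Matrix.mul_assoc]
    abel
  rw [IsContraction, e]
  exact h

/-- A Hermitian matrix has a Hermitian generalized inverse. -/
theorem exists_isHermitian_pseudoinverse [DecidableEq n] {H : Matrix n n ℂ} (hH : H.IsHermitian) :
    ∃ G : Matrix n n ℂ, G.IsHermitian ∧ H * G * H = H ∧ G * H * G = G := by
  set U : Matrix n n ℂ := hH.eigenvectorUnitary.1 with hU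
  set d : n → ℂ := fun i => (hH.eigenvalues i : ℂ) with hd
  have hUU : U.conjTranspose * U = 1 := by
    simpa [Matrix.star_eq_conjTranspose] using Unitary.coe_star_mul_self hH.eigenvectorUnitary
  have hs : H = U * Matrix.diagonal d * U.conjTranspose := by
    have h := hH.spectral_theorem
    rw [Unitary.conjStarAlgAut_apply] at h
    exact h
  have key : ∀ a b c : n → ℂ, U * Matrix.diagonal a * U.conjTranspose *
      (U * Matrix.diagonal b * U.conjTranspose) * (U * Matrix.diagonal c * U.conjTranspose) =
      U * Matrix.diagonal (fun i => a i * b i * c i) * U.conjTranspose := by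
    intro a b c
    have : ∀ X Y : Matrix n n ℂ, U * X * U.conjTranspose * (U * Y * U.conjTranspose) =
        U * (X * Y) * U.conjTranspose := by
      intro X Y
      calc _ = U * X * (U.conjTranspose * U) * Y * U.conjTranspose := by
            simp only [Matrix.mul_assoc]
        _ = _ := by rw [hUU]; simp only [Matrix.mul_assoc, Matrix.mul_one]
    rw [this, this, Matrix.diagonal_mul_diagonal, Matrix.diagonal_mul_diagonal]
  -- Invert the eigenvalues; the convention `0⁻¹ = 0` makes this a generalized inverse on the
  -- kernel.
  refine ⟨U * Matrix.diagonal (fun i => (d i)⁻¹) * U.conjTranspose, ?_, ?_, ?_⟩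
  · rw [Matrix.IsHermitian, Matrix.conjTranspose_mul, Matrix.conjTranspose_mul,
      Matrix.conjTranspose_conjTranspose, Matrix.diagonal_conjTranspose, Matrix.mul_assoc]
    congr 3
    ext i
    simp [hd]
  · rw [hs, key]
    congr 3
    ext i
    by_cases h : d i = 0 <;> simp [h]
  · rw [hs, key]
    congr 3
    ext i
    by_cases h : d i = 0 <;> simp [h]

/-- Two matrices with the same Gram matrix differ by a contraction. -/
theorem exists_contraction_of_gram_eq [DecidableEq m] [DecidableEq n]
    {X : Matrix m n ℂ} {Y : Matrix p n ℂ}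
    (h : X.conjTranspose * X = Y.conjTranspose * Y) :
    ∃ V : Matrix p m ℂ, IsContraction V ∧ Y = V * X := by
  obtain ⟨G, hG, h1, h2⟩ := exists_isHermitian_pseudoinverse
    (Matrix.isHermitian_conjTranspose_mul_self X)
  have h1' : Y.conjTranspose * Y * G * (Y.conjTranspose * Y) = Y.conjTranspose * Y := by
    rw [← h, h1]
  have hGe : G.conjTranspose = G := hG
  -- With `G` a generalized inverse of the common Gram matrix, `V† V = X G X†` is an orthogonal
  -- projection, so `1 - V† V` is its own square. That `Y - V X` vanishes follows because its Gram
  -- matrix does.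
  refine ⟨Y * G * X.conjTranspose, ?_, ?_⟩
  · have e : (1 : Matrix m m ℂ) - (Y * G * X.conjTranspose).conjTranspose * (Y * G * X.conjTranspose)
        = (1 - X * G * X.conjTranspose).conjTranspose * (1 - X * G * X.conjTranspose) := by
      have e1 : (Y * G * X.conjTranspose).conjTranspose * (Y * G * X.conjTranspose) =
          X * G * X.conjTranspose := by
        calc _ = X * (G * (Y.conjTranspose * Y) * G) * X.conjTranspose := by
              simp only [Matrix.conjTranspose_mul, Matrix.conjTranspose_conjTranspose, hGe,
                Matrix.mul_assoc]
          _ = _ := by rw [← h, h2]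
      have e2 : X * G * X.conjTranspose * (X * G * X.conjTranspose) = X * G * X.conjTranspose := by
        calc _ = X * (G * (X.conjTranspose * X) * G) * X.conjTranspose := by
              simp only [Matrix.mul_assoc]
          _ = _ := by rw [h2]
      have e3 : (X * G * X.conjTranspose).conjTranspose = X * G * X.conjTranspose := by
        simp only [Matrix.conjTranspose_mul, Matrix.conjTranspose_conjTranspose, hGe,
          Matrix.mul_assoc]
      rw [e1, Matrix.conjTranspose_sub, e3, Matrix.conjTranspose_one, Matrix.sub_mul,
        Matrix.mul_sub, Matrix.mul_sub, e2]
      simp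
    rw [IsContraction, e]
    exact Matrix.posSemidef_conjTranspose_mul_self _
  · rw [← sub_eq_zero]
    have e : Y * G * X.conjTranspose * X = Y * G * (Y.conjTranspose * Y) := by
      rw [← h, Matrix.mul_assoc _ _ X]
    rw [e, ← Matrix.conjTranspose_mul_self_eq_zero]
    have e4 : (Y - Y * G * (Y.conjTranspose * Y)).conjTranspose =
        Y.conjTranspose - Y.conjTranspose * Y * G * Y.conjTranspose := by
      simp only [Matrix.conjTranspose_sub, Matrix.conjTranspose_mul,
        Matrix.conjTranspose_conjTranspose, hGe, Matrix.mul_assoc]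
    have e5 : Y.conjTranspose * (Y * G * (Y.conjTranspose * Y)) = Y.conjTranspose * Y := by
      simpa only [Matrix.mul_assoc] using h1'
    have e6 : Y.conjTranspose * Y * G * Y.conjTranspose * Y = Y.conjTranspose * Y := by
      rw [Matrix.mul_assoc, h1']
    have e7 : Y.conjTranspose * Y * G * Y.conjTranspose * (Y * G * (Y.conjTranspose * Y)) =
        Y.conjTranspose * Y := by
      calc _ = (Y.conjTranspose * Y * G * (Y.conjTranspose * Y)) * G * (Y.conjTranspose * Y) := by
            simp only [Matrix.mul_assoc]
        _ = _ := by rw [h1', h1']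
    rw [e4, Matrix.sub_mul, Matrix.mul_sub, Matrix.mul_sub, e5, e6, e7]
    simp

/-- The operator `2 - W - W†` is positive, being `(1 - W)†(1 - W) + (1 - W† W)`; pair it with `S =
B† B`. -/
theorem IsContraction.re_trace_mul_le [DecidableEq n] {W S : Matrix n n ℂ}
    (hW : IsContraction W) (hS : S.PosSemidef) : (W * S).trace.re ≤ S.trace.re := by
  obtain ⟨B, rfl⟩ : ∃ B : Matrix n n ℂ, S = B.conjTranspose * B :=
    CStarAlgebra.nonneg_iff_eq_star_mul_self.mp hS.nonneg
  have hcyc : ∀ T : Matrix n n ℂ,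
      (B * T * B.conjTranspose).trace = (T * (B.conjTranspose * B)).trace := by
    intro T
    rw [Matrix.trace_mul_cycle, Matrix.trace_mul_comm]
  have h1 := ((Matrix.posSemidef_conjTranspose_mul_self (1 - W)).add
    hW).mul_mul_conjTranspose_same B |>.trace_nonneg
  rw [hcyc] at h1
  have e : (1 - W).conjTranspose * (1 - W) + (1 - W.conjTranspose * W) =
      2 - W - W.conjTranspose := by
    rw [Matrix.conjTranspose_sub, Matrix.conjTranspose_one, Matrix.sub_mul, Matrix.mul_sub,
      Matrix.mul_sub, Matrix.mul_one, Matrix.mul_one, Matrix.one_mul, ← one_add_one_eq_two]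
    abel
  have h2 : (W.conjTranspose * (B.conjTranspose * B)).trace =
      star (W * (B.conjTranspose * B)).trace := by
    rw [← Matrix.trace_conjTranspose, Matrix.conjTranspose_mul, Matrix.conjTranspose_mul,
      Matrix.conjTranspose_conjTranspose, Matrix.trace_mul_comm]
  rw [e, Matrix.sub_mul, Matrix.sub_mul, Matrix.trace_sub, Matrix.trace_sub, h2, two_mul,
    Matrix.trace_add] at h1
  have h3 := (Complex.le_def.mp h1).1
  simp at h3 ⊢
  linarith

end Contractions

/-! ### Trace norm and root fidelity. -/

section Fidelity

variable {m n : Type*} [Fintype m] [DecidableEq m] [Fintype n] [DecidableEq n]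

theorem sqrt_posSemidef (X : Matrix n n ℂ) : (CFC.sqrt X).PosSemidef :=
  Matrix.nonneg_iff_posSemidef.mp (CFC.sqrt_nonneg X)

theorem conjTranspose_sqrt (X : Matrix n n ℂ) : (CFC.sqrt X).conjTranspose = CFC.sqrt X :=
  (sqrt_posSemidef X).isHermitian

theorem sqrt_mul_sqrt {X : Matrix n n ℂ} (hX : X.PosSemidef) : CFC.sqrt X * CFC.sqrt X = X :=
  CFC.sqrt_mul_sqrt_self X hX.nonneg

theorem traceNorm_nonneg (Z : Matrix n n ℂ) : 0 ≤ traceNorm Z :=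
  (Complex.le_def.mp (sqrt_posSemidef _).trace_nonneg).1

theorem gram_sqrt_gram (Z : Matrix n n ℂ) :
    (CFC.sqrt (Z.conjTranspose * Z)).conjTranspose * CFC.sqrt (Z.conjTranspose * Z) =
      Z.conjTranspose * Z := by
  rw [conjTranspose_sqrt, sqrt_mul_sqrt (Matrix.posSemidef_conjTranspose_mul_self Z)]

/-- Polar form: `Z = V |Z|` with `V` a contraction, and `K V` is again a contraction. -/
theorem re_trace_mul_le_traceNorm {K : Matrix n n ℂ} (hK : IsContraction K) (Z : Matrix n n ℂ) :
    (K * Z).trace.re ≤ traceNorm Z := by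
  obtain ⟨V, hV, h⟩ := exists_contraction_of_gram_eq (gram_sqrt_gram Z)
  have e : K * Z = K * V * CFC.sqrt (Z.conjTranspose * Z) := by
    rw [Matrix.mul_assoc, ← h]
  rw [e]
  exact (hK.mul hV).re_trace_mul_le (sqrt_posSemidef _)

theorem exists_contraction_traceNorm_eq (Z : Matrix n n ℂ) :
    ∃ V : Matrix n n ℂ, IsContraction V ∧ traceNorm Z = (V * Z).trace.re := by
  obtain ⟨V, hV, h⟩ := exists_contraction_of_gram_eq (gram_sqrt_gram Z).symm
  exact ⟨V, hV, by rw [← h, traceNorm]⟩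

/-- The off-diagonal block of a positive block matrix bounds the root fidelity from below. -/
theorem re_trace_le_of_block {w t X : Matrix n n ℂ}
    (h : (Matrix.fromBlocks w X.conjTranspose X t).PosSemidef) :
    X.trace.re ≤ traceNorm (CFC.sqrt w * CFC.sqrt t) := by
  obtain ⟨B, hB⟩ : ∃ B : Matrix (n ⊕ n) (n ⊕ n) ℂ,
      Matrix.fromBlocks w X.conjTranspose X t = B.conjTranspose * B :=
    CStarAlgebra.nonneg_iff_eq_star_mul_self.mp h.nonneg
  -- The two column blocks of a Gram factor give `w = B₁† B₁`, `X = B₂† B₁`, `t = B₂† B₂`. Comparing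
  -- each with the square root of its Gram matrix yields `X = √t K √w` with `K` a contraction.
  set B₁ : Matrix (n ⊕ n) n ℂ := B.submatrix id Sum.inl with hB₁
  set B₂ : Matrix (n ⊕ n) n ℂ := B.submatrix id Sum.inr with hB₂
  have hw : w = B₁.conjTranspose * B₁ := by
    ext i j
    simpa [Matrix.mul_apply, hB₁] using congrFun (congrFun hB (Sum.inl i)) (Sum.inl j)
  have hX : X = B₂.conjTranspose * B₁ := by
    ext i j
    simpa [Matrix.mul_apply, hB₁, hB₂] using congrFun (congrFun hB (Sum.inr i)) (Sum.inl j)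
  have ht : t = B₂.conjTranspose * B₂ := by
    ext i j
    simpa [Matrix.mul_apply, hB₂] using congrFun (congrFun hB (Sum.inr i)) (Sum.inr j)
  have hs : ∀ (C : Matrix (n ⊕ n) n ℂ),
      (CFC.sqrt (C.conjTranspose * C)).conjTranspose * CFC.sqrt (C.conjTranspose * C) =
        C.conjTranspose * C := fun C => by
    rw [conjTranspose_sqrt, sqrt_mul_sqrt (Matrix.posSemidef_conjTranspose_mul_self C)]
  obtain ⟨V₁, hV₁, h₁⟩ := exists_contraction_of_gram_eq (hs B₁)
  obtain ⟨V₂, hV₂, h₂⟩ := exists_contraction_of_gram_eq (hs B₂)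
  rw [← hw] at h₁
  rw [← ht] at h₂
  have e : X = CFC.sqrt t * (V₂.conjTranspose * V₁) * CFC.sqrt w := by
    calc X = (V₂ * CFC.sqrt t).conjTranspose * (V₁ * CFC.sqrt w) := by rw [← h₁, ← h₂, hX]
      _ = _ := by
        rw [Matrix.conjTranspose_mul, conjTranspose_sqrt]
        simp only [Matrix.mul_assoc]
  have e2 : X.trace = (V₂.conjTranspose * V₁ * (CFC.sqrt w * CFC.sqrt t)).trace := by
    rw [e, Matrix.mul_assoc, Matrix.trace_mul_comm]
    simp only [Matrix.mul_assoc]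
  rw [e2]
  exact re_trace_mul_le_traceNorm (hV₂.conjTranspose.mul hV₁) _

/-- The root fidelity of `A A†` and `B B†` is attained by a contraction. -/
theorem exists_contraction_rootFidelity_eq (A B : Matrix n m ℂ) :
    ∃ U : Matrix m m ℂ, IsContraction U ∧
      traceNorm (CFC.sqrt (A * A.conjTranspose) * CFC.sqrt (B * B.conjTranspose)) =
        (U * (A.conjTranspose * B)).trace.re := by
  have hs : ∀ C : Matrix n m ℂ, ∃ W : Matrix n m ℂ, IsContraction W ∧
      CFC.sqrt (C * C.conjTranspose) = W * C.conjTranspose := fun C => by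
    refine exists_contraction_of_gram_eq ?_
    rw [conjTranspose_sqrt, sqrt_mul_sqrt (Matrix.posSemidef_self_mul_conjTranspose C),
      Matrix.conjTranspose_conjTranspose]
  obtain ⟨V, hV, h⟩ := exists_contraction_traceNorm_eq
    (CFC.sqrt (A * A.conjTranspose) * CFC.sqrt (B * B.conjTranspose))
  obtain ⟨W₁, hW₁, h₁⟩ := hs A
  obtain ⟨W₂, hW₂, h₂⟩ := hs B
  refine ⟨W₂.conjTranspose * (V * W₁), hW₂.conjTranspose.mul (hV.mul hW₁), ?_⟩
  have h₂' : CFC.sqrt (B * B.conjTranspose) = B * W₂.conjTranspose := by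
    rw [← conjTranspose_sqrt, h₂, Matrix.conjTranspose_mul, Matrix.conjTranspose_conjTranspose]
  rw [h, h₂', h₁]
  congr 1
  calc _ = ((V * (W₁ * A.conjTranspose) * B) * W₂.conjTranspose).trace := by
        simp only [Matrix.mul_assoc]
    _ = _ := by
        rw [Matrix.trace_mul_comm]
        simp only [Matrix.mul_assoc]

theorem fidelity_nonneg (w t : Matrix n n ℂ) : 0 ≤ fidelity w t := sq_nonneg _

end Fidelity

/-! ### The Choi correspondence. -/

section Choi

variable {R C D : Type*}

theorem choi_apply [DecidableEq C] (N : Matrix C C ℂ →ₗ[ℂ] Matrix D D ℂ) (x y : C × D) :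
    choi N x y = N (Matrix.single x.1 y.1 1) x.2 y.2 := by
  have h : (Matrix.of fun c c' => gammaOp C (x.1, c) (y.1, c')) = Matrix.single x.1 y.1 1 := by
    ext c c'
    by_cases h : x.1 = c <;> by_cases h' : y.1 = c' <;>
      simp [gammaOp, gammaVec, Matrix.vecMulVec_apply, h, h']
  rw [choi, idTensor, Matrix.of_apply, h]

variable [Fintype C]

theorem apply_eq_sum_choi [DecidableEq C] (N : Matrix C C ℂ →ₗ[ℂ] Matrix D D ℂ)
    (X : Matrix C C ℂ) (d d' : D) :
    N X d d' = ∑ c, ∑ c', X c c' * choi N (c, d) (c', d') := by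
  conv_lhs => rw [Matrix.matrix_eq_sum_single X]
  simp only [map_sum, Matrix.sum_apply]
  refine Finset.sum_congr rfl fun c _ => Finset.sum_congr rfl fun c' _ => ?_
  have h : Matrix.single c c' (X c c') = X c c' • Matrix.single c c' (1 : ℂ) := by
    rw [Matrix.smul_single, smul_eq_mul, mul_one]
  rw [h, map_smul, Matrix.smul_apply, smul_eq_mul, choi_apply]

/-- The linear map with a given Choi operator. -/
def ofChoi (J : Matrix (C × D) (C × D) ℂ) : Matrix C C ℂ →ₗ[ℂ] Matrix D D ℂ where
  toFun X := Matrix.of fun d d' => ∑ c, ∑ c', X c c' * J (c, d) (c', d')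
  map_add' X Y := by
    ext d d'
    simp [add_mul, Finset.sum_add_distrib]
  map_smul' a X := by
    ext d d'
    simp [mul_assoc, Finset.mul_sum]

theorem choi_ofChoi [DecidableEq C] (J : Matrix (C × D) (C × D) ℂ) : choi (ofChoi J) = J := by
  ext x y
  rw [choi_apply, ofChoi]
  simp only [LinearMap.coe_mk, AddHom.coe_mk, Matrix.of_apply]
  rw [Finset.sum_eq_single x.1, Finset.sum_eq_single y.1]
  · simp
  · intro c _ hc
    simp [Matrix.single_apply_of_col_ne _ _ hc.symm]
  · simp
  · intro c _ hc
    simp [Matrix.single_apply_of_row_ne hc.symm]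
  · simp

variable [Fintype D]

/-- Trace preservation in terms of the Choi operator. -/
theorem traceSnd_choi_eq_one_iff [DecidableEq C] (N : Matrix C C ℂ →ₗ[ℂ] Matrix D D ℂ) :
    traceSnd (choi N) = 1 ↔ ∀ X, (N X).trace = X.trace := by
  constructor
  · intro h X
    have h' : ∀ c c', ∑ d, choi N (c, d) (c', d) = (1 : Matrix C C ℂ) c c' := fun c c' => by
      rw [← h]; rfl
    simp only [Matrix.trace, Matrix.diag_apply, apply_eq_sum_choi N]
    rw [Finset.sum_comm]
    refine Finset.sum_congr rfl fun c _ => ?_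
    rw [Finset.sum_comm]
    simp only [← Finset.mul_sum, h']
    simp [Matrix.one_apply]
  · intro h
    ext c c'
    have e : traceSnd (choi N) c c' = (N (Matrix.single c c' 1)).trace := by
      simp [traceSnd, choi_apply, Matrix.trace]
    rw [e, h, Matrix.one_apply]
    by_cases hc : c = c'
    · subst hc; simp
    · simp [hc, Matrix.trace_single_eq_of_ne c c' (1 : ℂ) hc]

variable [DecidableEq D]

theorem kronecker_one_mul_mul_apply (K : Matrix R C ℂ) (J : Matrix (C × D) (C × D) ℂ)
    (x y : R × D) :
    ((K ⊗ₖ (1 : Matrix D D ℂ)) * J * (K ⊗ₖ (1 : Matrix D D ℂ)).conjTranspose) x y =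
      ∑ c, ∑ c', K x.1 c * star (K y.1 c') * J (c, x.2) (c', y.2) := by
  rw [Matrix.mul_apply, Fintype.sum_prod_type, Finset.sum_comm]
  simp only [Matrix.mul_apply, Fintype.sum_prod_type, Matrix.kroneckerMap_apply,
    Matrix.conjTranspose_apply, Matrix.one_apply, mul_ite, mul_one, mul_zero, ite_mul, zero_mul,
    Finset.sum_ite_eq, Finset.mem_univ, if_true, apply_ite star, star_zero]
  rw [Finset.sum_comm]
  simp only [Finset.sum_ite_eq, Finset.mem_univ, if_true, Finset.sum_mul]
  rw [Finset.sum_comm]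
  refine Finset.sum_congr rfl fun c _ => Finset.sum_congr rfl fun c' _ => ?_
  ring

/-- The action of `id ⊗ N` on a sum of rank-one operators, in terms of the Choi operator. -/
theorem idTensor_eq_sum_choi [DecidableEq C] {κ : Type*} [Fintype κ]
    (N : Matrix C C ℂ →ₗ[ℂ] Matrix D D ℂ) {X : Matrix (R × C) (R × C) ℂ} {K : κ → Matrix R C ℂ}
    (hX : ∀ x y, X x y = ∑ k, K k x.1 x.2 * star (K k y.1 y.2)) :
    idTensor R N X = ∑ k, (K k ⊗ₖ (1 : Matrix D D ℂ)) * choi N *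
      (K k ⊗ₖ (1 : Matrix D D ℂ)).conjTranspose := by
  ext x y
  rw [Matrix.sum_apply]
  simp only [kronecker_one_mul_mul_apply, idTensor, Matrix.of_apply, apply_eq_sum_choi N, hX]
  rw [Finset.sum_comm]
  conv_rhs => rw [Finset.sum_comm]
  rw [Finset.sum_comm]
  refine Finset.sum_congr rfl fun c _ => ?_
  rw [Finset.sum_comm]
  conv_rhs => rw [Finset.sum_comm]
  rw [Finset.sum_comm]
  refine Finset.sum_congr rfl fun c' _ => ?_
  rw [Finset.sum_mul]

theorem exists_sum_rankOne_of_posSemidef [Fintype R] [DecidableEq R] [DecidableEq C]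
    {X : Matrix (R × C) (R × C) ℂ} (hX : X.PosSemidef) :
    ∃ K : R × C → Matrix R C ℂ, ∀ x y, X x y = ∑ k, K k x.1 x.2 * star (K k y.1 y.2) := by
  obtain ⟨B, rfl⟩ : ∃ B : Matrix (R × C) (R × C) ℂ, X = B.conjTranspose * B :=
    CStarAlgebra.nonneg_iff_eq_star_mul_self.mp hX.nonneg
  refine ⟨fun k => Matrix.of fun r c => star (B k (r, c)), fun x y => ?_⟩
  simp [Matrix.mul_apply]

/-- Choi's theorem. -/
theorem isCP_iff_posSemidef_choi [DecidableEq C] (N : Matrix C C ℂ →ₗ[ℂ] Matrix D D ℂ) :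
    IsCP N ↔ (choi N).PosSemidef := by
  constructor
  · intro h
    -- Complete positivity is tested on references `Fin n` only, so the reference copy of `C` is
    -- relabelled.
    have e := Fintype.equivFin C
    have h1 := h (Fintype.card C)
      ((gammaOp C).submatrix (Prod.map e.symm id) (Prod.map e.symm id))
      ((Matrix.posSemidef_vecMulVec_self_star _).submatrix _)
    have h2 := h1.submatrix (Prod.map e id)
    convert h2 using 1
    ext x y
    simp [choi, idTensor]
  · intro h n X hX
    obtain ⟨K, hK⟩ := exists_sum_rankOne_of_posSemidef hX
    rw [idTensor_eq_sum_choi N hK]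
    exact Matrix.posSemidef_sum _ fun k _ => h.mul_mul_conjTranspose_same _

theorem trace_kronecker_one_mul (σ : Matrix C C ℂ) (Q : Matrix (C × D) (C × D) ℂ) :
    ((σ ⊗ₖ (1 : Matrix D D ℂ)) * Q).trace = (σ * traceSnd Q).trace := by
  simp only [Matrix.trace, Matrix.diag_apply, Matrix.mul_apply, Fintype.sum_prod_type,
    Matrix.kroneckerMap_apply, Matrix.one_apply, mul_ite, mul_one, mul_zero, ite_mul, zero_mul,
    Finset.sum_ite_eq, Finset.mem_univ, if_true, traceSnd, Matrix.of_apply, Finset.mul_sum]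
  refine Finset.sum_congr rfl fun c _ => ?_
  rw [Finset.sum_comm]

theorem trace_kronecker_one_conj [Fintype R] (K : Matrix R C ℂ) (Q : Matrix (C × D) (C × D) ℂ) :
    ((K ⊗ₖ (1 : Matrix D D ℂ)) * Q * (K ⊗ₖ (1 : Matrix D D ℂ)).conjTranspose).trace =
      (K.conjTranspose * K * traceSnd Q).trace := by
  rw [Matrix.trace_mul_cycle, Matrix.conjTranspose_kronecker, Matrix.conjTranspose_one,
    ← Matrix.mul_kronecker_mul, Matrix.one_mul, trace_kronecker_one_mul]

end Choi

/-! ### Compactness and duality for the positive cone. -/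

section PosSemidef

variable {n : Type*}

theorem isCompact_of_isClosed_of_norm_apply_le {s : Set (Matrix n n ℂ)} (hs : IsClosed s) (b : ℝ)
    (hb : ∀ X ∈ s, ∀ i j, ‖X i j‖ ≤ b) : IsCompact s := by
  have h : IsCompact (Set.univ.pi fun _ : n => Set.univ.pi fun _ : n =>
      Metric.closedBall (0 : ℂ) b) :=
    isCompact_univ_pi fun _ => isCompact_univ_pi fun _ => isCompact_closedBall 0 b
  refine IsCompact.of_isClosed_subset h hs fun X hX => ?_
  exact fun i _ j _ => mem_closedBall_zero_iff.mpr (hb X hX i j)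

variable [Fintype n]

/-- Entries are inner products of Gram vectors whose squared norms sum to the trace. This bounds the
sets of states and of feasible blocks, hence makes them compact. -/
theorem norm_apply_le_re_trace [DecidableEq n] {X : Matrix n n ℂ} (hX : X.PosSemidef) (i j : n) :
    ‖X i j‖ ≤ X.trace.re := by
  obtain ⟨B, rfl⟩ : ∃ B : Matrix n n ℂ, X = B.conjTranspose * B :=
    CStarAlgebra.nonneg_iff_eq_star_mul_self.mp hX.nonneg
  have ht : (B.conjTranspose * B).trace.re = ∑ l, ∑ k, ‖B k l‖ ^ 2 := by
    simp only [Matrix.trace, Matrix.diag_apply, Matrix.mul_apply, Matrix.conjTranspose_apply,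
      Complex.re_sum, Complex.star_def, Complex.conj_mul']
    norm_cast
  have hle : ∀ l, ∑ k, ‖B k l‖ ^ 2 ≤ (B.conjTranspose * B).trace.re := fun l => by
    rw [ht]
    exact Finset.single_le_sum (f := fun l => ∑ k, ‖B k l‖ ^ 2)
      (fun l _ => Finset.sum_nonneg fun k _ => sq_nonneg _) (Finset.mem_univ l)
  calc ‖(B.conjTranspose * B) i j‖ ≤ ∑ k, ‖B k i‖ * ‖B k j‖ := by
        rw [Matrix.mul_apply]
        refine (norm_sum_le _ _).trans (le_of_eq ?_)
        simp
    _ ≤ ∑ k, (‖B k i‖ ^ 2 + ‖B k j‖ ^ 2) / 2 :=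
        Finset.sum_le_sum fun k _ => by nlinarith [sq_nonneg (‖B k i‖ - ‖B k j‖)]
    _ = (∑ k, ‖B k i‖ ^ 2 + ∑ k, ‖B k j‖ ^ 2) / 2 := by
        rw [← Finset.sum_add_distrib, Finset.sum_div]
    _ ≤ _ := by linarith [hle i, hle j]

theorem isClosed_setOf_posSemidef : IsClosed {X : Matrix n n ℂ | X.PosSemidef} := by
  have e : {X : Matrix n n ℂ | X.PosSemidef} =
      {X | X.conjTranspose = X} ∩ ⋂ x : n → ℂ, {X | 0 ≤ star x ⬝ᵥ (X.mulVec x)} := by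
    ext X
    simp only [Set.mem_ofPred_eq, Set.mem_inter_iff, Set.mem_iInter]
    exact Matrix.posSemidef_iff_dotProduct_mulVec
  rw [e]
  refine (isClosed_eq (by fun_prop) continuous_id).inter (isClosed_iInter fun x => ?_)
  exact isClosed_le continuous_const (by fun_prop)

theorem convex_setOf_isState : Convex ℝ {σ : Matrix n n ℂ | IsState σ} := by
  rintro X ⟨hX, hX'⟩ Y ⟨hY, hY'⟩ a b ha hb hab
  refine ⟨(hX.smul ha).add (hY.smul hb), ?_⟩
  rw [Matrix.trace_add, Matrix.trace_smul, Matrix.trace_smul, hX', hY', ← add_smul, hab, one_smul]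

theorem isCompact_setOf_isState [DecidableEq n] : IsCompact {σ : Matrix n n ℂ | IsState σ} := by
  refine isCompact_of_isClosed_of_norm_apply_le ?_ 1 ?_
  · exact isClosed_setOf_posSemidef.inter (isClosed_eq (by fun_prop) continuous_const)
  · rintro X ⟨hX, hX'⟩ i j
    simpa [hX'] using norm_apply_le_re_trace hX i j

theorem exists_isState (n : Type*) [Fintype n] [DecidableEq n] [Nonempty n] :
    ∃ σ : Matrix n n ℂ, IsState σ := by
  refine ⟨Matrix.single (Classical.arbitrary n) (Classical.arbitrary n) 1, ?_, by simp⟩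
  rw [← Matrix.diagonal_single]
  refine Matrix.PosSemidef.diagonal fun i => ?_
  by_cases h : i = Classical.arbitrary n <;> simp [h]

theorem re_trace_mul_realPart {σ : Matrix n n ℂ} (hσ : σ.IsHermitian) (T : Matrix n n ℂ) :
    (σ * (realPart T : Matrix n n ℂ)).trace.re = (σ * T).trace.re := by
  have h : (σ * T.conjTranspose).trace = star (σ * T).trace := by
    rw [← Matrix.trace_conjTranspose, Matrix.conjTranspose_mul, hσ.eq, Matrix.trace_mul_comm]
  rw [realPart_apply_coe, Matrix.star_eq_conjTranspose, Matrix.mul_smul, Matrix.mul_add,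
    Matrix.trace_smul, Matrix.trace_add, h]
  simp
  ring

/-- Self-duality of the positive cone: a product of positive operators has nonnegative trace, and
rank-one tests `|x⟩⟨x|` recover positivity. -/
theorem le_realPart_iff [DecidableEq n] {l : ℝ} {T : Matrix n n ℂ} :
    (l : ℂ) • (1 : Matrix n n ℂ) ≤ (realPart T : Matrix n n ℂ) ↔
      ∀ σ : Matrix n n ℂ, σ.PosSemidef → l * σ.trace.re ≤ (σ * T).trace.re := by
  constructor
  · intro h σ hσ
    rw [Matrix.le_iff] at h
    obtain ⟨B, hB⟩ : ∃ B : Matrix n n ℂ, σ = B.conjTranspose * B :=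
      CStarAlgebra.nonneg_iff_eq_star_mul_self.mp hσ.nonneg
    have h1 := (h.mul_mul_conjTranspose_same B).trace_nonneg
    rw [Matrix.trace_mul_cycle, ← hB, Matrix.mul_sub, Matrix.trace_sub, Matrix.mul_smul,
      Matrix.mul_one, Matrix.trace_smul] at h1
    have h2 := (Complex.le_def.mp h1).1
    rw [← re_trace_mul_realPart hσ.isHermitian]
    simp at h2 ⊢
    linarith
  · intro h
    rw [Matrix.le_iff]
    have hH : ((realPart T : Matrix n n ℂ) - (l : ℂ) • 1).IsHermitian := by
      refine Matrix.IsHermitian.sub (realPart T).2 ?_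
      rw [Matrix.IsHermitian, Matrix.conjTranspose_smul, Matrix.conjTranspose_one]
      simp
    refine Matrix.PosSemidef.of_dotProduct_mulVec_nonneg hH fun x => ?_
    have h1 := h _ (Matrix.posSemidef_vecMulVec_self_star x)
    rw [← re_trace_mul_realPart (Matrix.posSemidef_vecMulVec_self_star x).isHermitian] at h1
    have h2 : ∀ Y : Matrix n n ℂ, (Matrix.vecMulVec x (star x) * Y).trace =
        star x ⬝ᵥ (Y.mulVec x) := fun Y => by
      rw [Matrix.trace_mul_comm, Matrix.mul_vecMulVec, Matrix.trace_vecMulVec, dotProduct_comm]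
    have h3 := h2 1
    rw [Matrix.mul_one, Matrix.one_mulVec] at h3
    rw [h2, h3] at h1
    have him := hH.im_star_dotProduct_mulVec_self x
    rw [Complex.le_def]
    refine ⟨?_, by simpa using him.symm⟩
    rw [Matrix.sub_mulVec, dotProduct_sub, Matrix.smul_mulVec, Matrix.one_mulVec, dotProduct_smul]
    simp
    linarith

end PosSemidef

/-! ### Positive block matrices. -/

section Block

variable {n : Type*}

theorem convex_setOf_block (w t : Matrix n n ℂ) :
    Convex ℝ {Q : Matrix n n ℂ | (Matrix.fromBlocks w Q.conjTranspose Q t).PosSemidef} := by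
  intro X hX Y hY a b ha hb hab
  have h := (Matrix.PosSemidef.smul hX ha).add (Matrix.PosSemidef.smul hY hb)
  rw [Matrix.fromBlocks_smul, Matrix.fromBlocks_smul, Matrix.fromBlocks_add, ← add_smul,
    ← add_smul, hab, one_smul, one_smul] at h
  rw [Set.mem_ofPred_eq]
  convert h using 2
  simp [Matrix.conjTranspose_smul]

variable [Fintype n]

theorem posSemidef_block_conj {m : Type*} [Fintype m] {w t Q : Matrix n n ℂ}
    (h : (Matrix.fromBlocks w Q.conjTranspose Q t).PosSemidef) (L : Matrix m n ℂ) :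
    (Matrix.fromBlocks (L * w * L.conjTranspose) (L * Q * L.conjTranspose).conjTranspose
      (L * Q * L.conjTranspose) (L * t * L.conjTranspose)).PosSemidef := by
  have h1 := h.mul_mul_conjTranspose_same (Matrix.fromBlocks L 0 0 L)
  convert h1 using 1
  rw [Matrix.fromBlocks_conjTranspose, Matrix.fromBlocks_multiply, Matrix.fromBlocks_multiply]
  simp [Matrix.mul_assoc]

variable [DecidableEq n]

/-- The block matrix equals `L L†` for `L` with rows `(√w, 0)` and `(√t U, √t V)`, where `V V† = 1 -
U U†`. -/
theorem posSemidef_block_of_contraction {w t U : Matrix n n ℂ} (hw : w.PosSemidef)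
    (ht : t.PosSemidef) (hU : IsContraction U) :
    (Matrix.fromBlocks w (CFC.sqrt t * U * CFC.sqrt w).conjTranspose
      (CFC.sqrt t * U * CFC.sqrt w) t).PosSemidef := by
  obtain ⟨V, hV⟩ : ∃ V : Matrix n n ℂ, 1 - U * U.conjTranspose = V * V.conjTranspose := by
    have h := hU.conjTranspose
    rw [IsContraction, Matrix.conjTranspose_conjTranspose] at h
    exact CStarAlgebra.nonneg_iff_eq_mul_star_self.mp h.nonneg
  have h := Matrix.posSemidef_self_mul_conjTranspose
    (Matrix.fromBlocks (CFC.sqrt w) 0 (CFC.sqrt t * U) (CFC.sqrt t * V))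
  convert h using 1
  rw [Matrix.fromBlocks_conjTranspose, Matrix.fromBlocks_multiply]
  congr 1
  · simp [conjTranspose_sqrt, sqrt_mul_sqrt hw]
  · simp [conjTranspose_sqrt, Matrix.mul_assoc]
  · simp [conjTranspose_sqrt]
  · simp only [Matrix.conjTranspose_mul, conjTranspose_sqrt]
    calc t = CFC.sqrt t * (U * U.conjTranspose + (1 - U * U.conjTranspose)) * CFC.sqrt t := by
          rw [add_sub_cancel, Matrix.mul_one, sqrt_mul_sqrt ht]
      _ = _ := by
          rw [hV]
          simp only [Matrix.mul_add, Matrix.add_mul, Matrix.mul_assoc]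

theorem isCompact_setOf_block (w t : Matrix n n ℂ) :
    IsCompact {Q : Matrix n n ℂ | (Matrix.fromBlocks w Q.conjTranspose Q t).PosSemidef} := by
  refine isCompact_of_isClosed_of_norm_apply_le ?_ (w.trace + t.trace).re ?_
  · refine isClosed_setOf_posSemidef.preimage
      (f := fun Q : Matrix n n ℂ => Matrix.fromBlocks w Q.conjTranspose Q t) ?_
    exact continuous_const.matrix_fromBlocks (by fun_prop) continuous_id continuous_const
  · intro Q hQ i j
    have h := norm_apply_le_re_trace hQ (Sum.inr i) (Sum.inl j)
    simpa [Matrix.trace, Fintype.sum_sum_type] using h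

/-- Compress the block matrix by the column `(1, -1)` and take the trace. -/
theorem re_trace_le_of_posSemidef_block {w t Q : Matrix n n ℂ}
    (h : (Matrix.fromBlocks w Q.conjTranspose Q t).PosSemidef) :
    2 * Q.trace.re ≤ w.trace.re + t.trace.re := by
  have h1 := (h.conjTranspose_mul_mul_same
    (Matrix.fromRows (1 : Matrix n n ℂ) (-1 : Matrix n n ℂ))).trace_nonneg
  rw [Matrix.conjTranspose_fromRows_eq_fromCols_conjTranspose, Matrix.fromCols_mul_fromBlocks,
    Matrix.fromCols_mul_fromRows] at h1
  simp at h1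
  have h2 := (Complex.le_def.mp h1).1
  simp at h2
  linarith

end Block

/-! ### The semidefinite program for the root channel fidelity. -/

section ChannelFidelity

variable {C D : Type*} [Fintype D]

theorem traceSnd_add (X Y : Matrix (C × D) (C × D) ℂ) :
    traceSnd (X + Y) = traceSnd X + traceSnd Y := by
  ext c c'
  simp [traceSnd, Finset.sum_add_distrib]

theorem traceSnd_smul (a : ℝ) (X : Matrix (C × D) (C × D) ℂ) :
    traceSnd (a • X) = a • traceSnd X := by
  ext c c'
  simp [traceSnd, Finset.mul_sum]

variable [Fintype C]

theorem trace_traceSnd (X : Matrix (C × D) (C × D) ℂ) : (traceSnd X).trace = X.trace := by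
  simp [traceSnd, Matrix.trace, Fintype.sum_prod_type]

variable [DecidableEq D]

theorem bddBelow_fidelities (N N' : Matrix C C ℂ →ₗ[ℂ] Matrix D D ℂ) :
    BddBelow {f : ℝ | ∃ (n : ℕ) (ρ : Matrix (Fin n × C) (Fin n × C) ℂ), IsState ρ ∧
      f = fidelity (idTensor (Fin n) N ρ) (idTensor (Fin n) N' ρ)} :=
  ⟨0, by rintro _ ⟨n, ρ, -, rfl⟩; exact fidelity_nonneg _ _⟩

variable [DecidableEq C] {N N' : Matrix C C ℂ →ₗ[ℂ] Matrix D D ℂ}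

/-- Feasibility for the semidefinite program of the root channel fidelity. -/
def RootFidelityFeasible (N N' : Matrix C C ℂ →ₗ[ℂ] Matrix D D ℂ) (l : ℝ)
    (Q : Matrix (C × D) (C × D) ℂ) : Prop :=
  (Matrix.fromBlocks (choi N) Q.conjTranspose Q (choi N')).PosSemidef ∧
    (l : ℂ) • (1 : Matrix C C ℂ) ≤ (realPart (traceSnd Q) : Matrix C C ℂ)

theorem RootFidelityFeasible.le_rootFidelity {l : ℝ} {Q : Matrix (C × D) (C × D) ℂ}
    (h : RootFidelityFeasible N N' l Q) {R : Type*} [Fintype R] [DecidableEq R]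
    {ρ : Matrix (R × C) (R × C) ℂ} (hρ : IsState ρ) :
    l ≤ traceNorm (CFC.sqrt (idTensor R N ρ) * CFC.sqrt (idTensor R N' ρ)) := by
  obtain ⟨K, hK⟩ := exists_sum_rankOne_of_posSemidef hρ.1
  set X := ∑ k, (K k ⊗ₖ (1 : Matrix D D ℂ)) * Q * (K k ⊗ₖ (1 : Matrix D D ℂ)).conjTranspose with hX
  have hb : (Matrix.fromBlocks (idTensor R N ρ) X.conjTranspose X (idTensor R N' ρ)).PosSemidef := by
    have h1 := Matrix.posSemidef_sum Finset.univ fun k _ =>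
      posSemidef_block_conj h.1 (K k ⊗ₖ (1 : Matrix D D ℂ))
    convert h1 using 1
    rw [idTensor_eq_sum_choi N hK, idTensor_eq_sum_choi N' hK, hX, Matrix.conjTranspose_sum]
    ext (i | i) (j | j) <;> simp [Matrix.sum_apply]
  refine le_trans ?_ (re_trace_le_of_block hb)
  have htr : ∑ k, ((K k).conjTranspose * K k).trace = 1 := by
    rw [← hρ.2]
    simp only [Matrix.trace, Matrix.diag_apply, hK, Matrix.mul_apply, Matrix.conjTranspose_apply]
    conv_rhs => rw [Finset.sum_comm]
    simp only [Fintype.sum_prod_type_right, mul_comm]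
  have h2 : ∀ k, l * ((K k).conjTranspose * K k).trace.re ≤
      ((K k).conjTranspose * K k * traceSnd Q).trace.re := fun k =>
    le_realPart_iff.mp h.2 _ (Matrix.posSemidef_conjTranspose_mul_self _)
  calc l = ∑ k, l * ((K k).conjTranspose * K k).trace.re := by
        rw [← Finset.mul_sum, ← Complex.re_sum, htr, Complex.one_re, mul_one]
    _ ≤ ∑ k, ((K k).conjTranspose * K k * traceSnd Q).trace.re := Finset.sum_le_sum fun k _ => h2 k
    _ = X.trace.re := by
        rw [hX, Matrix.trace_sum, Complex.re_sum]
        simp only [trace_kronecker_one_conj]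

theorem RootFidelityFeasible.le_sqrt_channelFidelity [Nonempty C] {l : ℝ}
    {Q : Matrix (C × D) (C × D) ℂ} (h : RootFidelityFeasible N N' l Q) (hl : 0 ≤ l) :
    l ≤ √(channelFidelity N N') := by
  refine Real.le_sqrt_of_sq_le (le_csInf ?_ ?_)
  · obtain ⟨ρ, hρ⟩ := exists_isState (Fin 1 × C)
    exact ⟨_, 1, ρ, hρ, rfl⟩
  · rintro _ ⟨n, ρ, hρ, rfl⟩
    exact pow_le_pow_left₀ hl (h.le_rootFidelity hρ) 2

/-- For every input state, the root channel fidelity is at most the best value of the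
corresponding linear functional on the feasible blocks. -/
theorem exists_block_sqrt_channelFidelity_le (hN : (choi N).PosSemidef)
    (hN' : (choi N').PosSemidef) {σ : Matrix C C ℂ} (hσ : IsState σ) :
    ∃ Q : Matrix (C × D) (C × D) ℂ,
      (Matrix.fromBlocks (choi N) Q.conjTranspose Q (choi N')).PosSemidef ∧
      √(channelFidelity N N') ≤ (σ * traceSnd Q).trace.re := by
  have e := Fintype.equivFin C
  -- The entries of `√σ`, read as a vector, form a pure input state whose marginal on `C` is the
  -- transpose of `σ`; `K† K = σ` is what the trace computation needs.
  set K : Matrix (Fin (Fintype.card C)) C ℂ := (CFC.sqrt σ).submatrix e.symm id with hK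
  have hKK : K.conjTranspose * K = σ := by
    rw [hK, Matrix.conjTranspose_submatrix, conjTranspose_sqrt, Matrix.submatrix_mul_equiv,
      sqrt_mul_sqrt hσ.1, Matrix.submatrix_id_id]
  set ρ : Matrix (Fin (Fintype.card C) × C) (Fin (Fintype.card C) × C) ℂ :=
    Matrix.vecMulVec (fun x => K x.1 x.2) (star fun x => K x.1 x.2) with hρ
  have hρK : ∀ x y, ρ x y = ∑ _k : Unit, K x.1 x.2 * star (K y.1 y.2) := fun x y => by
    simp [hρ, Matrix.vecMulVec_apply]
  have hρs : IsState ρ := by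
    refine ⟨Matrix.posSemidef_vecMulVec_self_star _, ?_⟩
    rw [← hσ.2, ← hKK]
    simp only [Matrix.trace, Matrix.diag_apply, hρ, Matrix.vecMulVec_apply, Matrix.mul_apply,
      Matrix.conjTranspose_apply, Pi.star_apply, Fintype.sum_prod_type_right, mul_comm]
  have hA : ∀ M : Matrix C C ℂ →ₗ[ℂ] Matrix D D ℂ, (choi M).PosSemidef →
      idTensor (Fin (Fintype.card C)) M ρ =
        (K ⊗ₖ (1 : Matrix D D ℂ) * CFC.sqrt (choi M)) *
          (K ⊗ₖ (1 : Matrix D D ℂ) * CFC.sqrt (choi M)).conjTranspose := fun M hM => by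
    rw [idTensor_eq_sum_choi M hρK, Finset.sum_const, Finset.card_univ, Fintype.card_unit,
      one_smul, Matrix.conjTranspose_mul, conjTranspose_sqrt]
    conv_lhs => rw [← sqrt_mul_sqrt hM]
    simp only [Matrix.mul_assoc]
  obtain ⟨U, hU, hF⟩ := exists_contraction_rootFidelity_eq
    (K ⊗ₖ (1 : Matrix D D ℂ) * CFC.sqrt (choi N)) (K ⊗ₖ (1 : Matrix D D ℂ) * CFC.sqrt (choi N'))
  rw [← hA N hN, ← hA N' hN'] at hF
  refine ⟨_, posSemidef_block_of_contraction hN hN' hU, ?_⟩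
  have hle : channelFidelity N N' ≤
      fidelity (idTensor (Fin (Fintype.card C)) N ρ) (idTensor (Fin (Fintype.card C)) N' ρ) :=
    csInf_le (bddBelow_fidelities N N') ⟨_, ρ, hρs, rfl⟩
  refine (Real.sqrt_le_sqrt hle).trans (le_of_eq ?_)
  rw [fidelity, Real.sqrt_sq (traceNorm_nonneg _), hF, ← trace_kronecker_one_mul, ← hKK]
  congr 1
  have hk : (K.conjTranspose * K) ⊗ₖ (1 : Matrix D D ℂ) =
      (K ⊗ₖ (1 : Matrix D D ℂ)).conjTranspose * (K ⊗ₖ (1 : Matrix D D ℂ)) := by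
    rw [Matrix.conjTranspose_kronecker, Matrix.conjTranspose_one, ← Matrix.mul_kronecker_mul,
      Matrix.one_mul]
  rw [hk, Matrix.conjTranspose_mul, conjTranspose_sqrt]
  set L := K ⊗ₖ (1 : Matrix D D ℂ)
  calc _ = ((U * CFC.sqrt (choi N)) * (L.conjTranspose * L * CFC.sqrt (choi N'))).trace := by
        simp only [Matrix.mul_assoc]
    _ = _ := by
        rw [Matrix.trace_mul_comm]
        simp only [Matrix.mul_assoc]

/-- The root channel fidelity is attained by a feasible point. -/
theorem exists_rootFidelityFeasible_sqrt [Nonempty C] (hN : (choi N).PosSemidef)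
    (hN' : (choi N').PosSemidef) :
    ∃ Q, RootFidelityFeasible N N' √(channelFidelity N N') Q := by
  set f : Matrix C C ℂ → Matrix (C × D) (C × D) ℂ → ℝ :=
    fun σ Q => (σ * traceSnd Q).trace.re with hf
  have hc : Continuous fun p : Matrix C C ℂ × Matrix (C × D) (C × D) ℂ => f p.1 p.2 := by
    have h : Continuous (traceSnd : Matrix (C × D) (C × D) ℂ → Matrix C C ℂ) := by
      unfold traceSnd
      fun_prop
    have h2 : Continuous fun p : Matrix C C ℂ × Matrix (C × D) (C × D) ℂ =>
        (p.1 * traceSnd p.2).trace := by fun_prop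
    exact Complex.continuous_re.comp h2
  have hl : ∀ σ σ' Q (a b : ℝ), f (a • σ + b • σ') Q = a • f σ Q + b • f σ' Q := by
    intro σ σ' Q a b
    simp [hf, Matrix.add_mul]
  have hr : ∀ σ Q Q' (a b : ℝ), f σ (a • Q + b • Q') = a • f σ Q + b • f σ Q' := by
    intro σ Q Q' a b
    simp [hf, Matrix.mul_add, traceSnd_add, traceSnd_smul]
  have cX := convex_setOf_isState (n := C)
  have cY := convex_setOf_block (choi N) (choi N')
  have hne : {Q : Matrix (C × D) (C × D) ℂ |
      (Matrix.fromBlocks (choi N) Q.conjTranspose Q (choi N')).PosSemidef}.Nonempty := by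
    obtain ⟨σ, hσ⟩ := exists_isState C
    obtain ⟨Q, hQ, -⟩ := exists_block_sqrt_channelFidelity_le hN hN' hσ
    exact ⟨Q, hQ⟩
  -- At the saddle point, the best value against the minimizing `σ` is at most the value of this
  -- single `Q` against any state.
  obtain ⟨σ, hσ, Q, hQ, hs⟩ := Sion.exists_isSaddlePointOn (f := f)
    (exists_isState C) cX isCompact_setOf_isState
    (fun Q _ => (hc.comp (Continuous.prodMk_left Q)).lowerSemicontinuous.lowerSemicontinuousOn _)
    (fun Q _ => ConvexOn.quasiconvexOn ⟨cX, fun σ _ σ' _ a b _ _ _ => (hl σ σ' Q a b).le⟩)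
    cY hne (isCompact_setOf_block _ _)
    (fun σ _ => (hc.comp (Continuous.prodMk_right σ)).upperSemicontinuous.upperSemicontinuousOn _)
    (fun σ _ => ConcaveOn.quasiconcaveOn ⟨cY, fun Q _ Q' _ a b _ _ _ => (hr σ Q Q' a b).ge⟩)
  obtain ⟨Q', hQ', hle⟩ := exists_block_sqrt_channelFidelity_le hN hN' hσ
  have hmin : ∀ τ : Matrix C C ℂ, IsState τ → √(channelFidelity N N') ≤ (τ * traceSnd Q).trace.re :=
    fun τ hτ => hle.trans (hs τ hτ Q' hQ')
  refine ⟨Q, hQ, le_realPart_iff.mpr fun τ hτ => ?_⟩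
  have ht := Complex.le_def.mp hτ.trace_nonneg
  have hte : τ.trace = (τ.trace.re : ℂ) := Complex.ext rfl (by simpa using ht.2.symm)
  -- Positive operators of nonzero trace are rescaled to states; those of trace zero vanish.
  rcases (show 0 ≤ τ.trace.re from ht.1).eq_or_lt with h0 | h0
  · have hz : τ = 0 := by
      rw [← hτ.trace_eq_zero_iff, hte, ← h0, Complex.ofReal_zero]
    simp [hz]
  · have h1 := hmin (τ.trace.re⁻¹ • τ) ⟨hτ.smul (inv_nonneg.mpr h0.le), by
      rw [Matrix.trace_smul, hte, Complex.ofReal_re, Complex.real_smul, ← Complex.ofReal_mul,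
        inv_mul_cancel₀ h0.ne', Complex.ofReal_one]⟩
    rw [Matrix.smul_mul, Matrix.trace_smul, Complex.smul_re, smul_eq_mul, inv_mul_eq_div,
      le_div_iff₀ h0] at h1
    exact h1

/-- Testing the operator inequality on the identity gives `l · dim C ≤ Re Tr Q`, and both Choi
operators have trace `dim C`. -/
theorem RootFidelityFeasible.le_one [Nonempty C] {l : ℝ} {Q : Matrix (C × D) (C × D) ℂ}
    (h : RootFidelityFeasible N N' l Q) (hN : traceSnd (choi N) = 1)
    (hN' : traceSnd (choi N') = 1) : l ≤ 1 := by
  have h1 := re_trace_le_of_posSemidef_block h.1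
  have h2 := le_realPart_iff.mp h.2 1 Matrix.PosSemidef.one
  rw [Matrix.one_mul, trace_traceSnd] at h2
  rw [← trace_traceSnd (choi N), ← trace_traceSnd (choi N'), hN, hN'] at h1
  have h3 : 0 < (1 : Matrix C C ℂ).trace.re := by
    simp [Matrix.trace_one, Fintype.card_pos]
  nlinarith

end ChannelFidelity

/-! ### The simulated channel. -/

section Simulation

variable {C R D : Type*} [Fintype C] [Fintype R]

theorem isCP_simulate {P : Matrix (C × R) (C × R) ℂ →ₗ[ℂ] Matrix D D ℂ} {ρ : Matrix R R ℂ}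
    (hP : IsCP P) (hρ : ρ.PosSemidef) : IsCP (simulate P ρ) := by
  intro n X hX
  exact hP n _ ((hX.kronecker hρ).submatrix (Equiv.prodAssoc (Fin n) C R).symm)

theorem isChannel_simulate [Fintype D] {P : Matrix (C × R) (C × R) ℂ →ₗ[ℂ] Matrix D D ℂ}
    {ρ : Matrix R R ℂ} (hP : IsChannel P) (hρ : IsState ρ) : IsChannel (simulate P ρ) := by
  refine ⟨isCP_simulate hP.1 hρ.1, fun X => ?_⟩
  change (P (X ⊗ₖ ρ)).trace = X.trace
  rw [hP.2, Matrix.trace_kronecker, hρ.2, mul_one]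

variable [DecidableEq C] [DecidableEq R]

/-- Applying a map through its Choi operator sums matching entries `ρ r r' * J r r'`; written as the
trace of a product, this puts a transpose on `ρ`. -/
theorem choi_simulate [Fintype D] [DecidableEq D]
    (P : Matrix (C × R) (C × R) ℂ →ₗ[ℂ] Matrix D D ℂ) (ρ : Matrix R R ℂ) :
    choi (simulate P ρ) = traceMid ((((1 : Matrix C C ℂ) ⊗ₖ ρ.transpose) ⊗ₖ
      (1 : Matrix D D ℂ)) * choi P) := by
  ext ⟨c, d⟩ ⟨c', d'⟩
  rw [choi_apply]
  change P (Matrix.single c c' 1 ⊗ₖ ρ) d d' = _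
  rw [apply_eq_sum_choi P]
  simp only [traceMid, Matrix.of_apply, Matrix.mul_apply, Fintype.sum_prod_type,
    Matrix.kroneckerMap_apply, Matrix.one_apply, Matrix.transpose_apply, ite_mul, mul_ite, one_mul,
    mul_one, zero_mul, mul_zero, Finset.sum_ite_eq, Finset.mem_univ, if_true, Matrix.single_apply]
  rw [Finset.sum_eq_single c]
  · simp
    exact Finset.sum_comm
  · intro b _ hb
    simp [hb.symm]
  · simp

end Simulation

/-! ### Partial transposes and PPT-preserving channels. -/

section Multipartite

variable {ι : Type*} [DecidableEq ι] {A Ah A' : ι → Type*}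

/-- Exchanging the `S`-coordinates of a pair is an involution. -/
theorem piecewise_eq_piecewise_iff {B : ι → Type*} (S : Finset ι) (a b x y : ∀ i, B i) :
    (S.piecewise b a = x ∧ S.piecewise a b = y) ↔ (a = S.piecewise y x ∧ b = S.piecewise x y) := by
  simp only [funext_iff, Finset.piecewise]
  constructor
  all_goals
    rintro ⟨h1, h2⟩
    constructor <;> intro i <;> specialize h1 i <;> specialize h2 i <;> by_cases h : i ∈ S <;>
      simp_all

theorem piecewise_eq_piecewise_comm_iff {B : ι → Type*} (S : Finset ι) (a b : ∀ i, B i) :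
    S.piecewise b a = S.piecewise a b ↔ a = b := by
  simp only [funext_iff, Finset.piecewise]
  refine forall_congr' fun i => ?_
  by_cases h : i ∈ S <;> simp [h, eq_comm]

variable [Fintype ι] [∀ i, DecidableEq (A i)] [∀ i, DecidableEq (Ah i)]

theorem transposeIn_single (S : Finset ι) (a b : (∀ i, A i) × (∀ i, Ah i)) :
    transposeIn S (Matrix.single a b (1 : ℂ)) =
      Matrix.single (S.piecewise b.1 a.1, S.piecewise b.2 a.2)
        (S.piecewise a.1 b.1, S.piecewise a.2 b.2) 1 := by
  ext x y
  change Matrix.single a b (1 : ℂ) (S.piecewise y.1 x.1, S.piecewise y.2 x.2)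
    (S.piecewise x.1 y.1, S.piecewise x.2 y.2) = _
  rw [Matrix.single_apply, Matrix.single_apply]
  congr 1
  rw [Prod.ext_iff, Prod.ext_iff, Prod.ext_iff, Prod.ext_iff, eq_iff_iff]
  have h1 := piecewise_eq_piecewise_iff S a.1 b.1 x.1 y.1
  have h2 := piecewise_eq_piecewise_iff S a.2 b.2 x.2 y.2
  tauto

theorem choi_transpose (S : Finset ι)
    (P : Matrix ((∀ i, A i) × (∀ i, Ah i)) ((∀ i, A i) × (∀ i, Ah i)) ℂ →ₗ[ℂ]
      Matrix (∀ i, A' i) (∀ i, A' i) ℂ) :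
    choi (transposeOut S ∘ₗ P ∘ₗ transposeIn S) = transposeAll S (choi P) := by
  ext x y
  rw [choi_apply, LinearMap.comp_apply, LinearMap.comp_apply, transposeIn_single]
  change P _ (S.piecewise y.2 x.2) (S.piecewise x.2 y.2) = choi P _ _
  rw [choi_apply]

variable [∀ i, Fintype (A i)] [∀ i, Fintype (Ah i)] [∀ i, Fintype (A' i)]
  [∀ i, DecidableEq (A' i)]

theorem isCPPTP_iff (P : Matrix ((∀ i, A i) × (∀ i, Ah i)) ((∀ i, A i) × (∀ i, Ah i)) ℂ →ₗ[ℂ]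
      Matrix (∀ i, A' i) (∀ i, A' i) ℂ) :
    IsCPPTP P ↔ (choi P).PosSemidef ∧ traceSnd (choi P) = 1 ∧
      ∀ S : Finset ι, (transposeAll S (choi P)).PosSemidef := by
  rw [IsCPPTP, IsChannel, isCP_iff_posSemidef_choi, traceSnd_choi_eq_one_iff, and_assoc]
  simp only [isCP_iff_posSemidef_choi, choi_transpose]

/-- The feasible operators `P` of the semidefinite program are the Choi operators of the completely
PPT-preserving channels. -/
theorem sdpFeasible_choi_iff
    {N : Matrix (∀ i, A i) (∀ i, A i) ℂ →ₗ[ℂ] Matrix (∀ i, A' i) (∀ i, A' i) ℂ}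
    {ρ : Matrix (∀ i, Ah i) (∀ i, Ah i) ℂ} {l : ℝ}
    {P : Matrix ((∀ i, A i) × (∀ i, Ah i)) ((∀ i, A i) × (∀ i, Ah i)) ℂ →ₗ[ℂ]
      Matrix (∀ i, A' i) (∀ i, A' i) ℂ}
    {Q : Matrix ((∀ i, A i) × (∀ i, A' i)) ((∀ i, A i) × (∀ i, A' i)) ℂ} :
    SDPFeasible N ρ l (choi P) Q ↔
      0 ≤ l ∧ IsCPPTP P ∧ RootFidelityFeasible N (simulate P ρ) l Q := by
  rw [isCPPTP_iff, RootFidelityFeasible, choi_simulate]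
  exact ⟨fun h => ⟨h.l_nonneg, ⟨h.P_nonneg, h.trace_P, h.ppt⟩, h.block_nonneg, h.le_realPart⟩,
    fun ⟨h1, ⟨h2, h3, h4⟩, h5, h6⟩ => ⟨h1, h2, h6, h3, h5, h4⟩⟩

theorem mem_sdpValues_iff
    {N : Matrix (∀ i, A i) (∀ i, A i) ℂ →ₗ[ℂ] Matrix (∀ i, A' i) (∀ i, A' i) ℂ}
    {ρ : Matrix (∀ i, Ah i) (∀ i, Ah i) ℂ} {l : ℝ} :
    l ∈ sdpValues N ρ ↔ 0 ≤ l ∧ ∃ P, IsCPPTP P ∧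
      ∃ Q, RootFidelityFeasible N (simulate P ρ) l Q := by
  constructor
  · rintro ⟨J, Q, h⟩
    rw [← choi_ofChoi J, sdpFeasible_choi_iff] at h
    exact ⟨h.1, _, h.2.1, Q, h.2.2⟩
  · rintro ⟨h0, P, hP, Q, hQ⟩
    exact ⟨choi P, Q, sdpFeasible_choi_iff.mpr ⟨h0, hP, hQ⟩⟩

/-- The channel that discards its input and prepares the maximally mixed state is completely
PPT-preserving. -/
theorem exists_isCPPTP [Nonempty (∀ i, A' i)] :
    ∃ P : Matrix ((∀ i, A i) × (∀ i, Ah i)) ((∀ i, A i) × (∀ i, Ah i)) ℂ →ₗ[ℂ]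
      Matrix (∀ i, A' i) (∀ i, A' i) ℂ, IsCPPTP P := by
  -- The factor normalizes the output trace; multiples of the identity are fixed by every partial
  -- transpose.
  set c : ℝ := (Fintype.card (∀ i, A' i) : ℝ)⁻¹ with hc
  have hcn : (Fintype.card (∀ i, A' i) : ℝ) ≠ 0 := Nat.cast_ne_zero.mpr Fintype.card_ne_zero
  set J : Matrix (((∀ i, A i) × (∀ i, Ah i)) × (∀ i, A' i))
    (((∀ i, A i) × (∀ i, Ah i)) × (∀ i, A' i)) ℂ := c • 1 with hJ
  have hpos : J.PosSemidef := Matrix.PosSemidef.one.smul (inv_nonneg.mpr (Nat.cast_nonneg _))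
  have htr : ∀ S : Finset ι, transposeAll S J = J := by
    intro S
    ext x y
    simp only [transposeAll, Matrix.of_apply, hJ, Matrix.smul_apply, Matrix.one_apply]
    congr 2
    rw [Prod.ext_iff, Prod.ext_iff, Prod.ext_iff, Prod.ext_iff, eq_iff_iff]
    simp only [piecewise_eq_piecewise_comm_iff]
  refine ⟨ofChoi J, (isCPPTP_iff _).mpr ?_⟩
  rw [choi_ofChoi]
  refine ⟨hpos, ?_, fun S => (htr S).symm ▸ hpos⟩
  ext a b
  simp only [traceSnd, Matrix.of_apply, hJ, Matrix.smul_apply, Matrix.one_apply, Prod.mk.injEq,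
    and_true, Finset.sum_const, Finset.card_univ]
  by_cases h : a = b
  · rw [if_pos h, hc, ← Nat.cast_smul_eq_nsmul ℝ, smul_smul, mul_inv_cancel₀ hcn,
      one_smul]
  · simp [h]

end Multipartite

end QSim

theorem mainTheorem11 (M : ℕ) (A Ah A' : Fin M → Type*)
    [∀ i, Fintype (A i)] [∀ i, DecidableEq (A i)] [∀ i, Nonempty (A i)]
    [∀ i, Fintype (Ah i)] [∀ i, DecidableEq (Ah i)]
    [∀ i, Fintype (A' i)] [∀ i, DecidableEq (A' i)]
    (N : Matrix (∀ i, A i) (∀ i, A i) ℂ →ₗ[ℂ] Matrix (∀ i, A' i) (∀ i, A' i) ℂ)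
    (hN : QSim.IsChannel N)
    (ρ : Matrix (∀ i, Ah i) (∀ i, Ah i) ℂ) (hρ : QSim.IsState ρ) :
    (QSim.simErrors N ρ).Nonempty ∧ BddBelow (QSim.simErrors N ρ) ∧
    (QSim.sdpValues N ρ).Nonempty ∧ BddAbove (QSim.sdpValues N ρ) ∧
    QSim.simErrorPPT N ρ = 1 - (sSup (QSim.sdpValues N ρ)) ^ 2 := by
  -- Over an empty output, trace preservation would force the identity of the nonempty input to have
  -- trace zero.
  have hne : Nonempty (∀ i, A' i) := by
    by_contra h
    rw [not_nonempty_iff] at h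
    have h1 := hN.2 1
    rw [Matrix.trace_one, Matrix.trace_eq_zero_of_isEmpty] at h1
    exact Nat.cast_ne_zero.mpr Fintype.card_ne_zero h1.symm
  obtain ⟨P₀, hP₀⟩ := QSim.exists_isCPPTP (A := A) (Ah := Ah) (A' := A')
  have hch : ∀ {P : Matrix ((∀ i, A i) × (∀ i, Ah i)) ((∀ i, A i) × (∀ i, Ah i)) ℂ →ₗ[ℂ]
      Matrix (∀ i, A' i) (∀ i, A' i) ℂ}, QSim.IsCPPTP P →
      QSim.IsChannel (QSim.simulate P ρ) := fun hP => QSim.isChannel_simulate hP.1 hρ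
  have hone : ∀ l ∈ QSim.sdpValues N ρ, l ≤ 1 := by
    intro l hl
    obtain ⟨-, P, hP, Q, hQ⟩ := QSim.mem_sdpValues_iff.mp hl
    exact hQ.le_one ((QSim.traceSnd_choi_eq_one_iff N).mpr hN.2)
      ((QSim.traceSnd_choi_eq_one_iff _).mpr (hch hP).2)
  have hmem : ∀ P, QSim.IsCPPTP P →
      √(QSim.channelFidelity N (QSim.simulate P ρ)) ∈ QSim.sdpValues N ρ := fun P hP =>
    QSim.mem_sdpValues_iff.mpr ⟨Real.sqrt_nonneg _, P, hP, QSim.exists_rootFidelityFeasible_sqrt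
      ((QSim.isCP_iff_posSemidef_choi _).mp hN.1) ((QSim.isCP_iff_posSemidef_choi _).mp (hch hP).1)⟩
  have hF : ∀ P, 0 ≤ QSim.channelFidelity N (QSim.simulate P ρ) := fun P =>
    Real.sInf_nonneg (by rintro _ ⟨n, σ, -, rfl⟩; exact QSim.fidelity_nonneg _ _)
  have hbdd : BddAbove (QSim.sdpValues N ρ) := ⟨1, hone⟩
  have hvne : (QSim.sdpValues N ρ).Nonempty := ⟨_, hmem P₀ hP₀⟩
  have herr : ∀ e ∈ QSim.simErrors N ρ, 1 - sSup (QSim.sdpValues N ρ) ^ 2 ≤ e := by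
    rintro _ ⟨P, hP, rfl⟩
    have h := pow_le_pow_left₀ (Real.sqrt_nonneg _) (le_csSup hbdd (hmem P hP)) 2
    rw [Real.sq_sqrt (hF P)] at h
    linarith
  have hene : (QSim.simErrors N ρ).Nonempty := ⟨_, P₀, hP₀, rfl⟩
  have hebdd : BddBelow (QSim.simErrors N ρ) := ⟨_, herr⟩
  refine ⟨hene, hebdd, hvne, hbdd, le_antisymm ?_ (le_csInf hene herr)⟩
  -- A feasible `l` is at most the root fidelity of its own channel `P`, whose error is at least the
  -- infimum.
  have hle : ∀ l ∈ QSim.sdpValues N ρ, l ≤ √(1 - QSim.simErrorPPT N ρ) := by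
    intro l hl
    obtain ⟨h0, P, hP, Q, hQ⟩ := QSim.mem_sdpValues_iff.mp hl
    have h1 : QSim.simErrorPPT N ρ ≤ 1 - QSim.channelFidelity N (QSim.simulate P ρ) :=
      csInf_le hebdd ⟨P, hP, rfl⟩
    exact (hQ.le_sqrt_channelFidelity h0).trans (Real.sqrt_le_sqrt (by linarith))
  -- `√` is zero on negative reals, so squaring it back requires this sign.
  have h1 : 0 ≤ 1 - QSim.simErrorPPT N ρ := by
    have h2 : QSim.simErrorPPT N ρ ≤ 1 - QSim.channelFidelity N (QSim.simulate P₀ ρ) :=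
      csInf_le hebdd ⟨P₀, hP₀, rfl⟩
    linarith [hF P₀]
  have h3 := pow_le_pow_left₀ ((Real.sqrt_nonneg _).trans (le_csSup hbdd (hmem P₀ hP₀)))
    (csSup_le hvne hle) 2
  rw [Real.sq_sqrt h1] at h3
  linarith
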